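/- Let $m\ge 2$ and let $(Y_{i,j})_{1\le i\ne j\le m}$ be random variables with finite alphabets such that, for all $i\neq j$, $$I\bigl(Y_{i,j},Y_{j,i};\{Y_{k,l}: k\ne l,\ (k,l)\neq (i,j),(j,i)\}\bigr)=0 .$$ Terminal $i\in\{1,\dots,m\}$ observes $n$ i.i.d. repetitions $X_i^n$ of $X_i=(Y_{i,j})_{j\neq i}$ and may generate private randomness $U_i$ (finite-valued, with $U_1,\dots,U_m$ mutually independent and independent of the observations). The terminals communicate interactively over a noiseless public channel: in each of finitely many time slots a designated terminal $i$ sends a symbol from a finite alphabet that is a function of $X_i^n$, $U_i$ and all earlier transmissions. Let $F$ denote all the transmissions. For $\varepsilon>0$, a function $K$ of $(X_1^n,\dots,X_m^n,U_1,\dots,U_m)$ with values in a finite set $\mathcal K$ is an $\varepsilon$-secret key for all terminals if each terminal $i$ can compute from $(X_i^n,U_i,F)$ an estimate $K_i$ with $\Pr[K_i=K]\ge 1-\varepsilon$, and $\frac1n I(K;F)\le\varepsilon$, and $\frac1n H(K)\ge\frac1n\log|\mathcal K|-\varepsilon$. A rate $R$ is achievable if for every $\varepsilon>0$ and all sufficiently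 large $n$ there is an $\varepsilon$-secret key with $\frac1n H(K)\ge R-\varepsilon$; the group secret key capacity $C_{SK}(\{1,\dots,m\})$ is the supremum of the achievable rates. Let $G_3$ be the weighted undirected complete graph on $\{1,\dots,m\}$ in which the edge $\{i,j\}$ has weight $I(Y_{i,j};Y_{j,i})$. A multi-cut of $G_3$ is a partition of the nodes into $L$ nonempty sets, $2\le L\le m$; its weight is the sum of the weights of the edges whose end-nodes lie in different sets, and its normalized weight is its weight divided by $L-1$. A cut is a multi-cut with $L=2$. Then $C_{SK}(\{1,\dots,m\})$ is at most the minimal normalized weight of the multi-cuts of $G_3$. Moreover, this minimal normalized weight, and hence also $C_{SK}(\{1,\dots,m\})$, is at most each of (i) the minimal weight of the cuts of $G_3$; (ii) the sum of the weights of all edges of $G_3$ divided by $m-1$. -/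

import Mathlib

open MeasureTheory Filter

noncomputable section

namespace GroupKey

/-! ### Entropy and mutual information of finite-valued random variables

Logarithms are natural; all quantities below use the same base. -/

section Information

variable {Ω S T : Type*} [MeasurableSpace Ω] [Fintype S] [Fintype T]

/-- Shannon entropy `H(Z) = -∑ P(Z = z) log P(Z = z)`. -/
def entropy (μ : Measure Ω) (Z : Ω → S) : ℝ :=
  ∑ z : S, Real.negMulLog (μ.real (Z ⁻¹' {z}))

/-- Mutual information `I(Z; W) = H(Z) + H(W) - H(Z, W)`. -/
def mutualInfo (μ : Measure Ω) (Z : Ω → S) (W : Ω → T) : ℝ :=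
  entropy μ Z + entropy μ W - entropy μ (fun ω => (Z ω, W ω))

end Information

/-! ### Secret key agreement by public discussion -/

/-- A public discussion and key agreement scheme of block length `n` for `m` terminals with finite
source alphabets `𝒳 i`.

Terminal `i` holds `X_i^n` and a private random variable `U_i` with values in `Fin (q i)`; the `U_i`
are independent of each other and of the source. In time slot `t` (`t = 0, …, slots - 1`) the
terminal `speaker t` sends over the public noiseless channel a symbol of `Fin L` that may depend on
its own observation and randomness and on all earlier transmissions; the values of `speaker` and
`send` at `t ≥ slots` are irrelevant. At the end terminal `i` computes its estimate `estimate i` of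
the key from what it knows. The key itself is a function of all the observations and randomness,
with values in `Fin keySize`. -/
structure Scheme (m : ℕ) (𝒳 : Fin m → Type*) (n : ℕ) where
  q : Fin m → ℕ
  randLaw : ∀ i, PMF (Fin (q i))
  slots : ℕ
  L : ℕ
  speaker : ℕ → Fin m
  send : ∀ t : ℕ, (Fin n → 𝒳 (speaker t)) → Fin (q (speaker t)) → (Fin t → Fin L) → Fin L
  keySize : ℕ
  key : (∀ i, Fin n → 𝒳 i) → (∀ i, Fin (q i)) → Fin keySize
  estimate : ∀ i, (Fin n → 𝒳 i) → Fin (q i) → (Fin slots → Fin L) → Fin keySize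

namespace Scheme

variable {m : ℕ} {𝒳 : Fin m → Type*} {n : ℕ} (c : Scheme m 𝒳 n)

/-- The first `t` public transmissions. -/
def transcript (x : ∀ i, Fin n → 𝒳 i) (u : ∀ i, Fin (c.q i)) : (t : ℕ) → (Fin t → Fin c.L)
  | 0 => Fin.elim0
  | t + 1 =>
    Fin.snoc (α := fun _ => Fin c.L) (transcript x u t)
      (c.send t (x (c.speaker t)) (u (c.speaker t)) (transcript x u t))

variable {Ω : Type*} [MeasurableSpace Ω]

/-- The sample space: `n` independent copies of the source, and the private randomness. -/
abbrev Sample (Ω : Type*) : Type _ := (Fin n → Ω) × (∀ i, Fin (c.q i))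

/-- The law of `n` independent copies of the source and the independent private randomness. -/
def law (μ : Measure Ω) : Measure (c.Sample Ω) :=
  (Measure.pi fun _ : Fin n => μ).prod (Measure.pi fun i => (c.randLaw i).toMeasure)

variable (X : ∀ i, Ω → 𝒳 i)

/-- The observation `X_i^n` of terminal `i`. -/
def obs (ω : c.Sample Ω) (i : Fin m) : Fin n → 𝒳 i := fun s => X i (ω.1 s)

/-- The key `K` as a random variable. -/
def keyRV (ω : c.Sample Ω) : Fin c.keySize := c.key (c.obs X ω) ω.2

/-- All the public transmissions `F` as a random variable. -/
def publicRV (ω : c.Sample Ω) : Fin c.slots → Fin c.L := c.transcript (c.obs X ω) ω.2 c.slots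

/-- The estimate `K_i` of the key at terminal `i` as a random variable. -/
def estimateRV (i : Fin m) (ω : c.Sample Ω) : Fin c.keySize :=
  c.estimate i (c.obs X ω i) (ω.2 i) (c.publicRV X ω)

/-- The scheme generates an `ε`-secret key for the set `A` of terminals: every terminal of `A`
recovers `K` with probability at least `1 - ε`, the key is nearly independent of the public
transmissions, and it is nearly uniform. -/
structure IsSecretKey (μ : Measure Ω) (A : Finset (Fin m)) (ε : ℝ) : Prop where
  recoverable : ∀ i ∈ A, 1 - ε ≤ (c.law μ).real {ω | c.estimateRV X i ω = c.keyRV X ω}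
  secret : mutualInfo (c.law μ) (c.keyRV X) (c.publicRV X) / n ≤ ε
  uniform : Real.log c.keySize / n - ε ≤ entropy (c.law μ) (c.keyRV X) / n

end Scheme

section Capacity

variable {m : ℕ} {𝒳 : Fin m → Type*} {Ω : Type*} [MeasurableSpace Ω]

/-- `R` is an achievable secret key rate for `A`: for every `ε > 0` and all large `n` there is an
`ε`-secret key of entropy rate `H(K) / n ≥ R - ε`. -/
def IsAchievableRate (μ : Measure Ω) (X : ∀ i, Ω → 𝒳 i) (A : Finset (Fin m)) (R : ℝ) : Prop :=
  ∀ ε : ℝ, 0 < ε → ∀ᶠ n : ℕ in atTop, ∃ c : Scheme m 𝒳 n,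
    c.IsSecretKey X μ A ε ∧ R - ε ≤ entropy (c.law μ) (c.keyRV X) / n

/-- The secret key capacity `C_SK(A)`, the supremum of the achievable rates. It is taken in the
extended reals, so that an upper bound on it is an upper bound on every achievable rate. -/
def secretKeyCapacity (μ : Measure Ω) (X : ∀ i, Ω → 𝒳 i) (A : Finset (Fin m)) : EReal :=
  ⨆ (R : ℝ) (_ : IsAchievableRate μ X A R), (R : EReal)

end Capacity

/-! ### The pair-wise independent network -/

section Network

variable {m : ℕ} {α : Fin m → Fin m → Type*} {Ω : Type*} [MeasurableSpace Ω]

/-- The observation `X_i = (Y_{i,j})_{j ≠ i}` of terminal `i`. -/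
def observation (Y : ∀ i j, Ω → α i j) (i : Fin m) (ω : Ω) : ∀ j : {j : Fin m // j ≠ i}, α i j :=
  fun j => Y i j ω

/-- `I(Y_{i,j}, Y_{j,i}; {Y_{k,l} : k ≠ l, (k,l) ≠ (i,j), (j,i)}) = 0` for all `i ≠ j`. -/
def PairwiseIndependent [∀ i j, Fintype (α i j)] (μ : Measure Ω) (Y : ∀ i j, Ω → α i j) : Prop :=
  ∀ i j : Fin m, i ≠ j →
    mutualInfo μ (fun ω => (Y i j ω, Y j i ω))
      (fun ω (p : {p : Fin m × Fin m // p.1 ≠ p.2 ∧ p ≠ (i, j) ∧ p ≠ (j, i)}) =>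
        Y p.1.1 p.1.2 ω) = 0

/-- The edge weights `I(Y_{i,j}; Y_{j,i})` of the undirected graph on the terminals. They are
symmetric in `i` and `j`. -/
def edgeWeight [∀ i j, Fintype (α i j)] (μ : Measure Ω) (Y : ∀ i j, Ω → α i j)
    (i j : Fin m) : ℝ :=
  mutualInfo μ (Y i j) (Y j i)

end Network

/-! ### Multi-cuts of a weighted undirected graph

The graph is the complete graph on `Fin m`; the edge `{i, j}` is listed once, with `i < j`, and has
weight `w i j`. A multi-cut is a partition of the nodes into at least two (nonempty) sets. -/

section Cuts

variable {m : ℕ}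

/-- The sum of the weights of the edges whose end-nodes lie in different sets of `P`. -/
def multiCutWeight (w : Fin m → Fin m → ℝ) (P : Finpartition (Finset.univ : Finset (Fin m))) : ℝ :=
  ∑ e : Fin m × Fin m with e.1 < e.2 ∧ P.part e.1 ≠ P.part e.2, w e.1 e.2

/-- The weight of a multi-cut into `L` sets divided by `L - 1`. -/
def normalizedWeight (w : Fin m → Fin m → ℝ)
    (P : Finpartition (Finset.univ : Finset (Fin m))) : ℝ :=
  multiCutWeight w P / ((P.parts.card : ℝ) - 1)

/-- The minimal normalized weight of the multi-cuts (there are finitely many). -/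
def minNormalizedWeight (w : Fin m → Fin m → ℝ) : EReal :=
  ⨅ (P : Finpartition (Finset.univ : Finset (Fin m))) (_ : 2 ≤ P.parts.card),
    (normalizedWeight w P : EReal)

/-- The minimal weight of the cuts, i.e. of the multi-cuts into exactly two sets. -/
def minCutWeight (w : Fin m → Fin m → ℝ) : EReal :=
  ⨅ (P : Finpartition (Finset.univ : Finset (Fin m))) (_ : P.parts.card = 2),
    (multiCutWeight w P : EReal)

/-- The sum of the weights of all edges. -/
def totalWeight (w : Fin m → Fin m → ℝ) : ℝ :=
  ∑ e : Fin m × Fin m with e.1 < e.2, w e.1 e.2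

end Cuts

end GroupKey

end

/-!
Group the terminals into the `l` blocks of a partition. Before the discussion, `∑ H(Z_b) - H(Z)` is
the total correlation of the blocks. A public discussion `F` satisfies
`H(F) + ∑ H(Z_b | F) ≤ ∑ H(Z_b)`, because each new symbol is a function of the past and of the
speaker's variable. A key `K` recoverable by every block lowers every `H(Z_b | F)` by `H(K | F)`,
up to a Fano term, while it lowers `H(Z | F)` only once, so `(l - 1) H(K | F)` is at most the total
correlation. The total correlation is additive over the `n` independent copies of the source and
ignores the private randomness, hence the capacity is at most the total correlation of the blocks of
`X` divided by `l - 1`.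

In the network, subadditivity bounds the entropy of each block by the sum of its entropies on the
single edges, and independence makes the total entropy the sum over the edges. An edge contributes
`H(Y_{i,j}) + H(Y_{j,i}) - H(Y_{i,j}, Y_{j,i}) = I(Y_{i,j}; Y_{j,i})` to the total correlation when
the partition cuts it and nothing otherwise. Cuts are the partitions into two blocks, and the
partition into singletons cuts every edge.
-/

namespace GroupKey

section Gibbs

lemma sum_negMulLog_le_sum_mul_neg_log {ι : Type*} (s : Finset ι) {p q : ι → ℝ}
    (hp : ∀ i ∈ s, 0 ≤ p i) (hq : ∀ i ∈ s, 0 ≤ q i) (hpq : ∀ i ∈ s, q i = 0 → p i = 0)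
    (hsum : ∑ i ∈ s, q i ≤ ∑ i ∈ s, p i) :
    ∑ i ∈ s, Real.negMulLog (p i) ≤ ∑ i ∈ s, p i * -Real.log (q i) := by
  have hterm : ∀ i ∈ s, Real.negMulLog (p i) ≤ p i * -Real.log (q i) + (q i - p i) := by
    intro i hi
    rcases (hp i hi).eq_or_lt with h0 | hpi
    · simpa [← h0] using hq i hi
    have hqi : 0 < q i := (hq i hi).lt_of_ne fun h => hpi.ne' (hpq i hi h.symm)
    have hlog := mul_le_mul_of_nonneg_left (Real.log_le_sub_one_of_pos (div_pos hqi hpi)) hpi.le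
    rw [Real.log_div hqi.ne' hpi.ne', mul_sub_one, mul_div_cancel₀ _ hpi.ne'] at hlog
    rw [Real.negMulLog]
    linarith
  have h := Finset.sum_le_sum hterm
  rw [Finset.sum_add_distrib, Finset.sum_sub_distrib] at h
  linarith

lemma mul_neg_log_mul_div {p a b c : ℝ} (hp : 0 ≤ p) (ha : p ≤ a) (hb : p ≤ b) (hc : p ≤ c) :
    p * -Real.log (a * b / c) = p * -Real.log a + p * -Real.log b - p * -Real.log c := by
  rcases hp.eq_or_lt with rfl | hpos
  · simp
  have ha' := (hpos.trans_le ha).ne'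
  have hb' := (hpos.trans_le hb).ne'
  rw [Real.log_div (mul_ne_zero ha' hb') (hpos.trans_le hc).ne', Real.log_mul ha' hb']
  ring

end Gibbs

section Entropy

variable {Ω S T : Type*} [MeasurableSpace Ω] {μ : Measure Ω}

lemma entropy_nonneg [IsProbabilityMeasure μ] [Fintype S] (X : Ω → S) : 0 ≤ entropy μ X :=
  Finset.sum_nonneg fun _ _ => Real.negMulLog_nonneg measureReal_nonneg measureReal_le_one

lemma entropy_of_subsingleton [IsProbabilityMeasure μ] [Fintype S] [Subsingleton S] (X : Ω → S) :
    entropy μ X = 0 := by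
  have huniv : ∀ s, X ⁻¹' {s} = Set.univ := fun s =>
    Set.eq_univ_of_forall fun ω => Subsingleton.elim (X ω) s
  simp [entropy, huniv]

variable [Fintype S] [MeasurableSpace S] [MeasurableSingletonClass S]

lemma sum_measureReal_preimage_singleton_univ [IsProbabilityMeasure μ] {X : Ω → S}
    (hX : Measurable X) : ∑ s, μ.real (X ⁻¹' {s}) = 1 := by
  rw [sum_measureReal_preimage_singleton _ fun s _ => hX (measurableSet_singleton s)]
  simp

lemma measureReal_preimage_comp_singleton [IsFiniteMeasure μ] [DecidableEq T] {X : Ω → S}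
    (hX : Measurable X) (g : S → T) (t : T) :
    μ.real ((fun ω => g (X ω)) ⁻¹' {t}) = ∑ s with g s = t, μ.real (X ⁻¹' {s}) := by
  rw [sum_measureReal_preimage_singleton _ fun s _ => hX (measurableSet_singleton s)]
  congr 1
  ext ω
  simp

lemma entropy_comp_eq_sum [IsFiniteMeasure μ] [Fintype T] {X : Ω → S} (hX : Measurable X)
    (g : S → T) :
    entropy μ (fun ω => g (X ω)) =
      ∑ s, μ.real (X ⁻¹' {s}) * -Real.log (μ.real ((fun ω => g (X ω)) ⁻¹' {g s})) := by
  classical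
  rw [entropy, ← Finset.sum_fiberwise Finset.univ g]
  refine Finset.sum_congr rfl fun t _ => ?_
  calc Real.negMulLog (μ.real ((fun ω => g (X ω)) ⁻¹' {t}))
      = (∑ s with g s = t, μ.real (X ⁻¹' {s})) *
          -Real.log (μ.real ((fun ω => g (X ω)) ⁻¹' {t})) := by
        rw [← measureReal_preimage_comp_singleton hX g t, Real.negMulLog, neg_mul_comm]
    _ = _ := by
        rw [Finset.sum_mul]
        refine Finset.sum_congr rfl fun s hs => ?_
        rw [(Finset.mem_filter.1 hs).2]

lemma entropy_comp_le [IsFiniteMeasure μ] [Fintype T] {X : Ω → S} (hX : Measurable X) (g : S → T) :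
    entropy μ (fun ω => g (X ω)) ≤ entropy μ X := by
  rw [entropy_comp_eq_sum hX g, entropy]
  refine Finset.sum_le_sum fun s _ => ?_
  rw [Real.negMulLog, neg_mul_comm]
  rcases (measureReal_nonneg (μ := μ) (s := X ⁻¹' {s})).eq_or_lt with h0 | hpos
  · simp [← h0]
  · have hsub : X ⁻¹' {s} ⊆ (fun ω => g (X ω)) ⁻¹' {g s} := fun ω hω => congrArg g hω
    have hmono := measureReal_mono (μ := μ) hsub
    gcongr

variable [IsProbabilityMeasure μ] [Fintype T] {X : Ω → S} {Y : Ω → T}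

lemma entropy_le_of_factorsThrough (hX : Measurable X) (h : Y.FactorsThrough X) :
    entropy μ Y ≤ entropy μ X := by
  have : Nonempty T := (nonempty_of_isProbabilityMeasure μ).map Y
  obtain ⟨g, rfl⟩ := (Function.factorsThrough_iff Y).1 h
  exact entropy_comp_le hX g

variable [MeasurableSpace T] [MeasurableSingletonClass T]

lemma entropy_eq_of_factorsThrough (hX : Measurable X) (hY : Measurable Y)
    (hYX : Y.FactorsThrough X) (hXY : X.FactorsThrough Y) : entropy μ Y = entropy μ X :=
  le_antisymm (entropy_le_of_factorsThrough hX hYX) (entropy_le_of_factorsThrough hY hXY)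

end Entropy

section Submodularity

variable {Ω S T U : Type*} [MeasurableSpace Ω] {μ : Measure Ω} [IsProbabilityMeasure μ]
  [Fintype S] [MeasurableSpace S] [MeasurableSingletonClass S]
  [Fintype T] [MeasurableSpace T] [MeasurableSingletonClass T]
  [Fintype U] [MeasurableSpace U] [MeasurableSingletonClass U]
  {X : Ω → S} {Y : Ω → T} {Z : Ω → U}

omit [Fintype U] in
lemma sum_measureReal_preimage_prodMk_left (hX : Measurable X) (hZ : Measurable Z) (u : U) :
    ∑ s, μ.real ((fun ω => (X ω, Z ω)) ⁻¹' {(s, u)}) = μ.real (Z ⁻¹' {u}) := by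
  have hunion : Z ⁻¹' {u} = ⋃ s ∈ Finset.univ, (fun ω => (X ω, Z ω)) ⁻¹' {(s, u)} := by
    ext ω
    simp
  rw [hunion, measureReal_biUnion_finset]
  · exact fun s _ s' _ hne => Set.disjoint_left.2 fun ω h h' => by simp_all
  · exact fun s _ => (hX.prodMk hZ) (measurableSet_singleton (s, u))

lemma sum_condIndep_eq_one (hX : Measurable X) (hY : Measurable Y) (hZ : Measurable Z) :
    ∑ a : (S × T) × U, μ.real ((fun ω => (X ω, Z ω)) ⁻¹' {(a.1.1, a.2)}) *
      μ.real ((fun ω => (Y ω, Z ω)) ⁻¹' {(a.1.2, a.2)}) / μ.real (Z ⁻¹' {a.2}) = 1 := by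
  simp_rw [Fintype.sum_prod_type_right (α₂ := U), ← Finset.sum_div, Fintype.sum_prod_type,
    ← Fintype.sum_mul_sum, sum_measureReal_preimage_prodMk_left hX hZ,
    sum_measureReal_preimage_prodMk_left hY hZ, mul_self_div_self]
  exact sum_measureReal_preimage_singleton_univ hZ

lemma entropy_prodMk_prodMk_add_le (hX : Measurable X) (hY : Measurable Y) (hZ : Measurable Z) :
    entropy μ (fun ω => ((X ω, Y ω), Z ω)) + entropy μ Z ≤
      entropy μ (fun ω => (X ω, Z ω)) + entropy μ (fun ω => (Y ω, Z ω)) := by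
  have hW : Measurable fun ω => ((X ω, Y ω), Z ω) := (hX.prodMk hY).prodMk hZ
  let p (a : (S × T) × U) : ℝ := μ.real ((fun ω => ((X ω, Y ω), Z ω)) ⁻¹' {a})
  let pXZ (a : (S × T) × U) : ℝ := μ.real ((fun ω => (X ω, Z ω)) ⁻¹' {(a.1.1, a.2)})
  let pYZ (a : (S × T) × U) : ℝ := μ.real ((fun ω => (Y ω, Z ω)) ⁻¹' {(a.1.2, a.2)})
  let pZ (a : (S × T) × U) : ℝ := μ.real (Z ⁻¹' {a.2})
  have hXZ : ∀ a, p a ≤ pXZ a := fun a => measureReal_mono fun ω hω => by simp_all [Prod.ext_iff]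
  have hYZ : ∀ a, p a ≤ pYZ a := fun a => measureReal_mono fun ω hω => by simp_all [Prod.ext_iff]
  have hpZ : ∀ a, p a ≤ pZ a := fun a => measureReal_mono fun ω hω => by simp_all [Prod.ext_iff]
  have hp : ∀ a, 0 ≤ p a := fun a => measureReal_nonneg
  have hgibbs : entropy μ (fun ω => ((X ω, Y ω), Z ω)) ≤
      ∑ a, p a * -Real.log (pXZ a * pYZ a / pZ a) := by
    refine sum_negMulLog_le_sum_mul_neg_log _ (fun a _ => hp a)
      (fun a _ => div_nonneg (mul_nonneg measureReal_nonneg measureReal_nonneg) measureReal_nonneg)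
      (fun a _ h => ?_)
      ((sum_condIndep_eq_one hX hY hZ).trans (sum_measureReal_preimage_singleton_univ hW).symm).le
    by_contra hne
    have hpos : 0 < p a := (hp a).lt_of_ne' hne
    exact (div_pos (mul_pos (hpos.trans_le (hXZ a)) (hpos.trans_le (hYZ a)))
      (hpos.trans_le (hpZ a))).ne' h
  simp_rw [mul_neg_log_mul_div (hp _) (hXZ _) (hYZ _) (hpZ _), Finset.sum_sub_distrib,
    Finset.sum_add_distrib] at hgibbs
  have hHXZ : entropy μ (fun ω => (X ω, Z ω)) = ∑ a, p a * -Real.log (pXZ a) :=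
    entropy_comp_eq_sum hW fun a => (a.1.1, a.2)
  have hHYZ : entropy μ (fun ω => (Y ω, Z ω)) = ∑ a, p a * -Real.log (pYZ a) :=
    entropy_comp_eq_sum hW fun a => (a.1.2, a.2)
  have hHZ : entropy μ Z = ∑ a, p a * -Real.log (pZ a) := entropy_comp_eq_sum hW Prod.snd
  linarith

/-- Submodularity: `J` and `M` play the join and the meet of `X` and `Y`. -/
lemma entropy_add_entropy_le_of_factorsThrough {V : Type*} [Fintype V] {J : Ω → V} {M : Ω → U}
    (hX : Measurable X) (hY : Measurable Y) (hM : Measurable M) (hMX : M.FactorsThrough X)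
    (hMY : M.FactorsThrough Y) (hJ : J.FactorsThrough fun ω => (X ω, Y ω)) :
    entropy μ J + entropy μ M ≤ entropy μ X + entropy μ Y := by
  have hJle : entropy μ J ≤ entropy μ (fun ω => ((X ω, Y ω), M ω)) :=
    entropy_le_of_factorsThrough (by fun_prop) fun ω ω' h => hJ (congrArg Prod.fst h)
  have hXM : entropy μ (fun ω => (X ω, M ω)) ≤ entropy μ X :=
    entropy_le_of_factorsThrough hX fun ω ω' h => Prod.ext h (hMX h)
  have hYM : entropy μ (fun ω => (Y ω, M ω)) ≤ entropy μ Y :=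
    entropy_le_of_factorsThrough hY fun ω ω' h => Prod.ext h (hMY h)
  linarith [entropy_prodMk_prodMk_add_le (μ := μ) hX hY hM]

end Submodularity

section CondEntropy

variable {Ω S T U : Type*} [MeasurableSpace Ω] {μ : Measure Ω} [Fintype S] [Fintype T] [Fintype U]

/-- The conditional entropy `H(X | Y) = H(X, Y) - H(Y)`. -/
noncomputable def condEntropy (μ : Measure Ω) (X : Ω → S) (Y : Ω → T) : ℝ :=
  entropy μ (fun ω => (X ω, Y ω)) - entropy μ Y

lemma entropy_sub_mutualInfo (X : Ω → S) (Y : Ω → T) :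
    entropy μ X - mutualInfo μ X Y = condEntropy μ X Y := by
  rw [mutualInfo, condEntropy]
  ring

variable [MeasurableSpace S] [MeasurableSingletonClass S] [MeasurableSpace T]
  [MeasurableSingletonClass T] [MeasurableSpace U] [MeasurableSingletonClass U]
  [IsProbabilityMeasure μ] {X : Ω → S} {Y : Ω → T} {Z : Ω → U}

lemma condEntropy_le_of_factorsThrough (hX : Measurable X) (hY : Measurable Y) (hZ : Measurable Z)
    (h : Y.FactorsThrough Z) : condEntropy μ X Z ≤ condEntropy μ X Y := by
  have hsub : entropy μ (fun ω => (X ω, Z ω)) + entropy μ Y ≤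
      entropy μ (fun ω => (X ω, Y ω)) + entropy μ Z :=
    entropy_add_entropy_le_of_factorsThrough (hX.prodMk hY) hZ hY
      (fun _ _ h => congrArg Prod.snd h) h (fun ω ω' h => by simp_all)
  rw [condEntropy, condEntropy]
  linarith

lemma condEntropy_prodMk_right_add (hX : Measurable X) (hY : Measurable Y) (hZ : Measurable Z) :
    condEntropy μ X (fun ω => (Z ω, Y ω)) + condEntropy μ Z Y =
      condEntropy μ X Y + condEntropy μ Z (fun ω => (X ω, Y ω)) := by
  have hswap : entropy μ (fun ω => (X ω, Z ω, Y ω)) = entropy μ (fun ω => (Z ω, X ω, Y ω)) :=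
    entropy_eq_of_factorsThrough (by fun_prop) (by fun_prop) (fun ω ω' h => by simp_all)
      (fun ω ω' h => by simp_all)
  rw [condEntropy, condEntropy, condEntropy, condEntropy, hswap]
  ring

lemma condEntropy_prodMk_le (hX : Measurable X) (hY : Measurable Y) (hZ : Measurable Z) :
    condEntropy μ (fun ω => (X ω, Y ω)) Z ≤ condEntropy μ X Z + condEntropy μ Y Z := by
  have hsub := entropy_prodMk_prodMk_add_le (μ := μ) hX hY hZ
  rw [condEntropy, condEntropy, condEntropy]
  linarith

lemma condEntropy_pi_le_sum {ι : Type*} [DecidableEq ι] {S : ι → Type*} [∀ i, Fintype (S i)]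
    [∀ i, MeasurableSpace (S i)] [∀ i, MeasurableSingletonClass (S i)] {X : ∀ i, Ω → S i}
    (s : Finset ι) (hX : ∀ i ∈ s, Measurable (X i)) (hY : Measurable Y) :
    condEntropy μ (fun ω (i : s) => X i ω) Y ≤ ∑ i ∈ s, condEntropy μ (X i) Y := by
  induction s using Finset.induction_on with
  | empty =>
    rw [condEntropy, Finset.sum_empty, sub_nonpos]
    exact entropy_le_of_factorsThrough hY fun _ _ h => Prod.ext (Subsingleton.elim _ _) h
  | insert a s ha ih =>
    have hXa := hX a (s.mem_insert_self a)
    have hXs : Measurable fun ω (i : s) => X i ω :=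
      measurable_pi_lambda _ fun i => hX i (Finset.mem_insert_of_mem i.2)
    have hsplit : condEntropy μ (fun ω (i : (insert a s : Finset ι)) => X i ω) Y ≤
        condEntropy μ (fun ω => (X a ω, fun i : s => X i ω)) Y := by
      refine sub_le_sub_right (entropy_le_of_factorsThrough ((hXa.prodMk hXs).prodMk hY) ?_) _
      intro ω ω' h
      simp_all [funext_iff]
    rw [Finset.sum_insert ha]
    exact hsplit.trans <| (condEntropy_prodMk_le hXa hXs hY).trans <|
      add_le_add_right (ih fun i hi => hX i (Finset.mem_insert_of_mem hi)) _

end CondEntropy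

section Fano

variable {Ω S T : Type*} [MeasurableSpace Ω] {μ : Measure Ω} [Fintype S] [DecidableEq S] [Fintype T]

/-- The probability of `s` for a guess that is `t` with probability `1 / 2` and uniform otherwise:
the reference law in the proof of Fano's inequality. -/
noncomputable def guessProb (t s : S) : ℝ :=
  ((if s = t then 1 else 0) + (Fintype.card S : ℝ)⁻¹) / 2

lemma guessProb_pos (t s : S) : 0 < guessProb t s := by
  have : Nonempty S := ⟨t⟩
  unfold guessProb
  positivity

lemma sum_guessProb (t : S) : ∑ s, guessProb t s = 1 := by
  have : Nonempty S := ⟨t⟩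
  simp only [guessProb, ← Finset.sum_div, Finset.sum_add_distrib]
  norm_num

lemma neg_log_guessProb_le (t s : S) :
    -Real.log (guessProb t s) ≤
      Real.log 2 + if t ≠ s then Real.log (Fintype.card S) else 0 := by
  have : Nonempty S := ⟨t⟩
  have hcard : (0 : ℝ) < Fintype.card S := by exact_mod_cast Fintype.card_pos
  by_cases h : s = t
  · have hle : (2 : ℝ)⁻¹ ≤ guessProb t s := by
      rw [guessProb, if_pos h, inv_eq_one_div]
      gcongr
      linarith [inv_pos.2 hcard]
    have hlog := Real.log_le_log (by norm_num) hle
    rw [Real.log_inv] at hlog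
    rw [if_neg (not_not.2 h.symm)]
    linarith
  · rw [guessProb, if_neg h, if_pos (Ne.symm h), zero_add,
      Real.log_div (inv_ne_zero hcard.ne') two_ne_zero, Real.log_inv]
    linarith

lemma mul_neg_log_mul_guessProb_le {p c : ℝ} (hp : 0 ≤ p) (hc : p ≤ c) (t s : S) :
    p * -Real.log (c * guessProb t s) ≤
      p * -Real.log c + (p * Real.log 2 + if t ≠ s then p * Real.log (Fintype.card S) else 0) := by
  rcases hp.eq_or_lt with rfl | hpos
  · simp
  have hguess := mul_le_mul_of_nonneg_left (neg_log_guessProb_le t s) hp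
  rw [mul_add, mul_ite_zero] at hguess
  rw [Real.log_mul (hpos.trans_le hc).ne' (guessProb_pos t s).ne', neg_add, mul_add]
  linarith

variable [MeasurableSpace S] [MeasurableSingletonClass S] [MeasurableSpace T]
  [MeasurableSingletonClass T] [IsProbabilityMeasure μ] {X : Ω → S} {Y : Ω → T}

lemma entropy_prodMk_le_sum_guessProb (hX : Measurable X) (hY : Measurable Y) (g : T → S) :
    entropy μ (fun ω => (X ω, Y ω)) ≤
      ∑ a : S × T, μ.real ((fun ω => (X ω, Y ω)) ⁻¹' {a}) *
        -Real.log (μ.real (Y ⁻¹' {a.2}) * guessProb (g a.2) a.1) := by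
  refine sum_negMulLog_le_sum_mul_neg_log _ (fun a _ => measureReal_nonneg)
    (fun a _ => mul_nonneg measureReal_nonneg (guessProb_pos _ _).le) (fun a _ h => ?_) ?_
  · have hle : μ.real ((fun ω => (X ω, Y ω)) ⁻¹' {a}) ≤ μ.real (Y ⁻¹' {a.2}) :=
      measureReal_mono fun ω hω => by simp_all [Prod.ext_iff]
    have h0 : μ.real (Y ⁻¹' {a.2}) = 0 :=
      (mul_eq_zero.1 h).resolve_right (guessProb_pos _ _).ne'
    exact le_antisymm (hle.trans h0.le) measureReal_nonneg
  · rw [sum_measureReal_preimage_singleton_univ (hX.prodMk hY)]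
    simp_rw [Fintype.sum_prod_type_right, ← Finset.mul_sum, sum_guessProb, mul_one]
    exact (sum_measureReal_preimage_singleton_univ hY).le

omit [DecidableEq S] in
lemma condEntropy_le_of_estimate (hX : Measurable X) (hY : Measurable Y) (g : T → S) :
    condEntropy μ X Y ≤
      Real.log 2 + μ.real {ω | g (Y ω) ≠ X ω} * Real.log (Fintype.card S) := by
  classical
  have hXY := hX.prodMk hY
  let p (a : S × T) : ℝ := μ.real ((fun ω => (X ω, Y ω)) ⁻¹' {a})
  have hterm : ∀ a : S × T, p a * -Real.log (μ.real (Y ⁻¹' {a.2}) * guessProb (g a.2) a.1) ≤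
      p a * -Real.log (μ.real (Y ⁻¹' {a.2})) +
        (p a * Real.log 2 + if g a.2 ≠ a.1 then p a * Real.log (Fintype.card S) else 0) :=
    fun a => mul_neg_log_mul_guessProb_le measureReal_nonneg
      (measureReal_mono fun ω hω => by simp_all [Prod.ext_iff]) _ _
  have hmarginal : entropy μ Y = ∑ a, p a * -Real.log (μ.real (Y ⁻¹' {a.2})) :=
    entropy_comp_eq_sum hXY Prod.snd
  have htotal : ∑ a, p a = 1 := sum_measureReal_preimage_singleton_univ hXY
  have herror : ∑ a : S × T with g a.2 ≠ a.1, p a = μ.real {ω | g (Y ω) ≠ X ω} := by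
    rw [sum_measureReal_preimage_singleton _ fun a _ => hXY (measurableSet_singleton a)]
    congr 1
    ext ω
    simp
  have hsum := (entropy_prodMk_le_sum_guessProb hX hY g).trans
    (Finset.sum_le_sum fun a _ => hterm a)
  rw [Finset.sum_add_distrib, Finset.sum_add_distrib, ← Finset.sum_mul, htotal, one_mul,
    ← Finset.sum_filter, ← Finset.sum_mul, herror, ← hmarginal] at hsum
  rw [condEntropy]
  linarith

end Fano

section Discussion

variable {Ω ι : Type*} {S : ι → Type*} {A : ℕ → Type*}

/-- A public discussion `F` among holders of the variables `Z b`, `b ∈ s`: each stage `F k` of the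
transcript determines the earlier ones and is extended by one participant, who uses only the
transcript so far and their own variable. -/
structure IsDiscussion (Z : ∀ b, Ω → S b) (s : Finset ι) (F : ∀ k, Ω → A k) : Prop where
  prev : ∀ k, (F k).FactorsThrough (F (k + 1))
  next : ∀ k, ∃ b ∈ s, (F (k + 1)).FactorsThrough fun ω => (Z b ω, F k ω)

variable [MeasurableSpace Ω] {μ : Measure Ω} [IsProbabilityMeasure μ]
  [∀ b, Fintype (S b)] [∀ b, MeasurableSpace (S b)] [∀ b, MeasurableSingletonClass (S b)]
  [∀ k, Fintype (A k)] [∀ k, MeasurableSpace (A k)] [∀ k, MeasurableSingletonClass (A k)]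
  {Z : ∀ b, Ω → S b} {s : Finset ι} {F : ∀ k, Ω → A k}

lemma IsDiscussion.entropy_add_sum_condEntropy_succ_le (h : IsDiscussion Z s F)
    (hZ : ∀ b ∈ s, Measurable (Z b)) (hF : ∀ k, Measurable (F k)) (k : ℕ) :
    entropy μ (F (k + 1)) + ∑ b ∈ s, condEntropy μ (Z b) (F (k + 1)) ≤
      entropy μ (F k) + ∑ b ∈ s, condEntropy μ (Z b) (F k) := by
  classical
  obtain ⟨b, hb, hnext⟩ := h.next k
  have hspeaker : entropy μ (F (k + 1)) + condEntropy μ (Z b) (F (k + 1)) ≤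
      entropy μ (F k) + condEntropy μ (Z b) (F k) := by
    rw [condEntropy, condEntropy, add_sub_cancel, add_sub_cancel]
    exact entropy_le_of_factorsThrough ((hZ b hb).prodMk (hF k)) fun ω ω' hω =>
      Prod.ext (Prod.ext_iff.1 hω).1 (hnext hω)
  have hlisteners : ∑ b' ∈ s.erase b, condEntropy μ (Z b') (F (k + 1)) ≤
      ∑ b' ∈ s.erase b, condEntropy μ (Z b') (F k) :=
    Finset.sum_le_sum fun b' hb' => condEntropy_le_of_factorsThrough
      (hZ b' (Finset.mem_of_mem_erase hb')) (hF k) (hF (k + 1)) (h.prev k)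
  rw [← Finset.add_sum_erase s _ hb, ← Finset.add_sum_erase s _ hb]
  linarith

variable [Subsingleton (A 0)]

lemma IsDiscussion.entropy_add_sum_condEntropy_le (h : IsDiscussion Z s F)
    (hZ : ∀ b ∈ s, Measurable (Z b)) (hF : ∀ k, Measurable (F k)) (k : ℕ) :
    entropy μ (F k) + ∑ b ∈ s, condEntropy μ (Z b) (F k) ≤ ∑ b ∈ s, entropy μ (Z b) := by
  induction k with
  | zero =>
    simp only [condEntropy, entropy_of_subsingleton (F 0), zero_add, sub_zero]
    exact Finset.sum_le_sum fun b hb => entropy_le_of_factorsThrough (hZ b hb)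
      fun _ _ hω => Prod.ext hω (Subsingleton.elim _ _)
  | succ k ih => exact (h.entropy_add_sum_condEntropy_succ_le hZ hF k).trans ih

variable {T U : Type*} [Fintype T] [MeasurableSpace T] [MeasurableSingletonClass T]
  [Fintype U] {K : Ω → T} {W : Ω → U} {δ : ℝ}

/-- `H(W)` is at most `H(K, F k) + ∑ H(Z b | K, F k)`, and learning `K` lowers each `H(Z b | F k)`
by `H(K | F k)`, up to the uncertainty `δ` about `K` that participant `b` is left with. -/
lemma IsDiscussion.card_sub_one_mul_condEntropy_le (h : IsDiscussion Z s F)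
    (hZ : ∀ b ∈ s, Measurable (Z b)) (hF : ∀ k, Measurable (F k)) (hK : Measurable K)
    (hW : W.FactorsThrough fun ω (b : s) => Z b ω) (k : ℕ)
    (hδ : ∀ b ∈ s, condEntropy μ K (fun ω => (Z b ω, F k ω)) ≤ δ) :
    ((s.card : ℝ) - 1) * condEntropy μ K (F k) ≤
      ∑ b ∈ s, entropy μ (Z b) - entropy μ W + s.card * δ := by
  classical
  have hKF := hK.prodMk (hF k)
  have hjoint : entropy μ W ≤ entropy μ (fun ω => (K ω, F k ω)) +
      ∑ b ∈ s, condEntropy μ (Z b) (fun ω => (K ω, F k ω)) := by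
    have hZs : Measurable fun ω (b : s) => Z b ω := measurable_pi_lambda _ fun b => hZ b b.2
    have hle := entropy_le_of_factorsThrough (μ := μ) (hZs.prodMk hKF)
      fun ω ω' hω => hW (congrArg Prod.fst hω)
    have hfamily := condEntropy_pi_le_sum (μ := μ) s hZ hKF
    rw [condEntropy] at hfamily
    linarith
  have hgain : ∀ b ∈ s, condEntropy μ (Z b) (fun ω => (K ω, F k ω)) ≤
      condEntropy μ (Z b) (F k) + (δ - condEntropy μ K (F k)) := fun b hb => by
    linarith [hδ b hb, condEntropy_prodMk_right_add (μ := μ) (hZ b hb) (hF k) hK]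
  have hsum := Finset.sum_le_sum hgain
  rw [Finset.sum_add_distrib, Finset.sum_const, nsmul_eq_mul, mul_sub] at hsum
  have hdiscussion := h.entropy_add_sum_condEntropy_le (μ := μ) hZ hF k
  have hKdef : entropy μ (fun ω => (K ω, F k ω)) = condEntropy μ K (F k) + entropy μ (F k) :=
    (sub_add_cancel _ _).symm
  linarith

end Discussion

section JointEntropy

variable {Ω ι : Type*} [MeasurableSpace Ω] [DecidableEq ι] {S : ι → Type*} [∀ i, Fintype (S i)]
  {μ : Measure Ω} {X : ∀ i, Ω → S i}

/-- The joint entropy `H(X_B)` of the subfamily `X_B = (X_i)_{i ∈ B}`. -/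
noncomputable def jointEntropy (μ : Measure Ω) (X : ∀ i, Ω → S i) (B : Finset ι) : ℝ :=
  entropy μ fun ω (i : B) => X i ω

variable [IsProbabilityMeasure μ]

lemma jointEntropy_nonneg (B : Finset ι) : 0 ≤ jointEntropy μ X B := entropy_nonneg _

lemma jointEntropy_empty : jointEntropy μ X ∅ = 0 := entropy_of_subsingleton _

variable [∀ i, MeasurableSpace (S i)] [∀ i, MeasurableSingletonClass (S i)]

lemma jointEntropy_univ [Fintype ι] (hX : ∀ i, Measurable (X i)) :
    jointEntropy μ X Finset.univ = entropy μ fun ω i => X i ω :=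
  entropy_eq_of_factorsThrough (by fun_prop) (by fun_prop)
    (fun _ _ h => funext fun i => congrFun h i)
    (fun _ _ h => funext fun i => congrFun h ⟨i, Finset.mem_univ i⟩)

lemma jointEntropy_insert (hX : ∀ i, Measurable (X i)) (a : ι) (B : Finset ι) :
    jointEntropy μ X (insert a B) = entropy μ fun ω => (X a ω, fun i : B => X i ω) :=
  entropy_eq_of_factorsThrough (by fun_prop) (by fun_prop)
    (fun ω ω' h => by simp_all [funext_iff])
    (fun ω ω' h => by simp_all [funext_iff])

lemma jointEntropy_singleton (hX : ∀ i, Measurable (X i)) (a : ι) :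
    jointEntropy μ X {a} = entropy μ (X a) :=
  entropy_eq_of_factorsThrough (hX a) (by fun_prop)
    (fun ω ω' h => by simp_all [funext_iff])
    (fun ω ω' h => by simp_all [funext_iff])

lemma jointEntropy_union_add_inter_le (hX : ∀ i, Measurable (X i)) (B C : Finset ι) :
    jointEntropy μ X (B ∪ C) + jointEntropy μ X (B ∩ C) ≤ jointEntropy μ X B + jointEntropy μ X C :=
  entropy_add_entropy_le_of_factorsThrough (by fun_prop) (by fun_prop) (by fun_prop)
    (fun _ _ h => funext fun i => congrFun h ⟨i, Finset.inter_subset_left i.2⟩)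
    (fun _ _ h => funext fun i => congrFun h ⟨i, Finset.inter_subset_right i.2⟩)
    (fun ω ω' h => funext fun i => (Finset.mem_union.1 i.2).elim
      (fun hB => congrFun (Prod.ext_iff.1 h).1 ⟨i, hB⟩)
      (fun hC => congrFun (Prod.ext_iff.1 h).2 ⟨i, hC⟩))

lemma jointEntropy_biUnion_le_sum {γ : Type*} (hX : ∀ i, Measurable (X i))
    (E : Finset γ) (R : γ → Finset ι) :
    jointEntropy μ X (E.biUnion R) ≤ ∑ e ∈ E, jointEntropy μ X (R e) := by
  classical
  induction E using Finset.induction_on with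
  | empty => simp [jointEntropy_empty]
  | insert a E ha ih =>
    rw [Finset.sum_insert ha, Finset.biUnion_insert]
    linarith [jointEntropy_union_add_inter_le (μ := μ) hX (R a) (E.biUnion R),
      jointEntropy_nonneg (μ := μ) (X := X) (R a ∩ E.biUnion R)]

lemma sum_jointEntropy_le_biUnion [Fintype ι] {γ : Type*} (hX : ∀ i, Measurable (X i))
    (E : Finset γ) (R : γ → Finset ι) (hdisj : (E : Set γ).PairwiseDisjoint R)
    (hind : ∀ e ∈ E, jointEntropy μ X (R e) + jointEntropy μ X (R e)ᶜ ≤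
      jointEntropy μ X Finset.univ) :
    ∑ e ∈ E, jointEntropy μ X (R e) ≤ jointEntropy μ X (E.biUnion R) := by
  classical
  induction E using Finset.induction_on with
  | empty => simp [jointEntropy_empty]
  | insert a E ha ih =>
    have hR : Disjoint (R a) (E.biUnion R) := (Finset.disjoint_biUnion_right _ _ _).2 fun e he =>
      hdisj (by simp) (by simp [he]) (ne_of_mem_of_not_mem he ha).symm
    have hsub := jointEntropy_union_add_inter_le (μ := μ) hX (R a ∪ E.biUnion R) (R a)ᶜ
    have hunion : R a ∪ E.biUnion R ∪ (R a)ᶜ = Finset.univ := by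
      rw [Finset.union_right_comm, Finset.union_compl,
        Finset.union_eq_left.2 (Finset.subset_univ _)]
    have hinter : (R a ∪ E.biUnion R) ∩ (R a)ᶜ = E.biUnion R := by
      rw [← Finset.sdiff_eq_inter_compl, Finset.union_sdiff_cancel_left hR]
    rw [hunion, hinter] at hsub
    rw [Finset.sum_insert ha, Finset.biUnion_insert]
    linarith [ih (hdisj.subset (by simp)) fun e he => hind e (Finset.mem_insert_of_mem he),
      hind a (Finset.mem_insert_self a E)]

/-- The total correlation `∑ H(X_B) - H(X)` between the blocks `B` of a partition. -/
noncomputable def partitionInfo [Fintype ι] (μ : Measure Ω) (X : ∀ i, Ω → S i)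
    (P : Finpartition (Finset.univ : Finset ι)) : ℝ :=
  ∑ B ∈ P.parts, jointEntropy μ X B - jointEntropy μ X Finset.univ

end JointEntropy

section Independence

variable {Ω Ω' S T : Type*} [MeasurableSpace Ω] [MeasurableSpace Ω'] {μ : Measure Ω}
  [Fintype S] [MeasurableSpace S] [MeasurableSingletonClass S]
  [Fintype T] [MeasurableSpace T] [MeasurableSingletonClass T]

lemma entropy_measurePreserving {μ' : Measure Ω'} {g : Ω → Ω'} (hg : MeasurePreserving g μ μ')
    {X : Ω' → S} (hX : Measurable X) : entropy μ (fun ω => X (g ω)) = entropy μ' X := by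
  refine Finset.sum_congr rfl fun s _ => ?_
  rw [← hg.measureReal_preimage (hX (measurableSet_singleton s)).nullMeasurableSet]
  rfl

lemma entropy_prodMk_of_indepFun [IsProbabilityMeasure μ] {X : Ω → S} {Y : Ω → T}
    (hX : Measurable X) (hY : Measurable Y) (h : ProbabilityTheory.IndepFun X Y μ) :
    entropy μ (fun ω => (X ω, Y ω)) = entropy μ X + entropy μ Y := by
  have hprod : ∀ s t, μ.real ((fun ω => (X ω, Y ω)) ⁻¹' {(s, t)}) =
      μ.real (X ⁻¹' {s}) * μ.real (Y ⁻¹' {t}) := fun s t => by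
    rw [← Set.singleton_prod_singleton, Set.mk_preimage_prod]
    simpa only [measureReal_def, ENNReal.toReal_mul] using congrArg ENNReal.toReal
      (h.measure_inter_preimage_eq_mul {s} {t} (measurableSet_singleton s)
        (measurableSet_singleton t))
  rw [entropy, Fintype.sum_prod_type]
  simp_rw [hprod, Real.negMulLog_mul, Finset.sum_add_distrib, ← Finset.sum_mul, ← Finset.mul_sum,
    ← Finset.sum_mul, sum_measureReal_preimage_singleton_univ hX,
    sum_measureReal_preimage_singleton_univ hY, one_mul]
  rfl

variable {ι : Type*} [DecidableEq ι] {S : ι → Type*} [∀ i, Fintype (S i)]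
  [∀ i, MeasurableSpace (S i)] [∀ i, MeasurableSingletonClass (S i)]

lemma jointEntropy_of_iIndepFun [IsProbabilityMeasure μ] {X : ∀ i, Ω → S i}
    (hX : ∀ i, Measurable (X i)) (h : ProbabilityTheory.iIndepFun X μ) (B : Finset ι) :
    jointEntropy μ X B = ∑ i ∈ B, entropy μ (X i) := by
  induction B using Finset.induction_on with
  | empty => rw [jointEntropy_empty, Finset.sum_empty]
  | insert a B ha ih =>
    have hind : ProbabilityTheory.IndepFun (X a) (fun ω (i : B) => X i ω) μ :=
      (h.indepFun_finset {a} B (Finset.disjoint_singleton_left.2 ha) hX).comp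
        (measurable_pi_apply (X := fun i : ({a} : Finset ι) => S i)
          ⟨a, Finset.mem_singleton_self a⟩) measurable_id
    rw [Finset.sum_insert ha, ← ih, jointEntropy_insert hX,
      entropy_prodMk_of_indepFun (hX a) (by fun_prop) hind, jointEntropy]

lemma jointEntropy_measurePi [Fintype ι] {Ω : ι → Type*} [∀ i, MeasurableSpace (Ω i)]
    {ν : ∀ i, Measure (Ω i)} [∀ i, IsProbabilityMeasure (ν i)] {X : ∀ i, Ω i → S i}
    (hX : ∀ i, Measurable (X i)) (B : Finset ι) :
    jointEntropy (Measure.pi ν) (fun i ω => X i (ω i)) B = ∑ i ∈ B, entropy (ν i) (X i) := by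
  rw [jointEntropy_of_iIndepFun (fun i => by fun_prop)
    (ProbabilityTheory.iIndepFun_pi fun i => (hX i).aemeasurable)]
  exact Finset.sum_congr rfl fun i _ =>
    entropy_measurePreserving (measurePreserving_eval ν i) (hX i)

lemma entropy_measurePi_const [Fintype ι] [IsProbabilityMeasure μ] {X : Ω → T}
    (hX : Measurable X) :
    entropy (Measure.pi fun _ : ι => μ) (fun ω i => X (ω i)) = Fintype.card ι * entropy μ X := by
  rw [← jointEntropy_univ (X := fun (i : ι) (ω : ι → Ω) => X (ω i)) fun i => by fun_prop,
    jointEntropy_measurePi fun _ => hX, Finset.sum_const, nsmul_eq_mul, Finset.card_univ]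

end Independence

namespace Scheme

variable {m n : ℕ} {𝒳 : Fin m → Type*} (c : Scheme m 𝒳 n) {Ω : Type*}

/-- The pair `(X_i^n, U_i)`: what terminal `i` knows before the discussion. -/
def terminalRV (X : ∀ i, Ω → 𝒳 i) (i : Fin m) (ω : c.Sample Ω) : (Fin n → 𝒳 i) × Fin (c.q i) :=
  (c.obs X ω i, ω.2 i)

variable {X : ∀ i, Ω → 𝒳 i}

lemma isDiscussion_transcript (P : Finpartition (Finset.univ : Finset (Fin m))) :
    IsDiscussion (fun (B : Finset (Fin m)) ω (i : B) => c.terminalRV X i ω) P.parts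
      (fun k ω => c.transcript (c.obs X ω) ω.2 k) where
  prev k ω ω' h := by
    simpa [transcript] using congrArg (Fin.init (α := fun _ => Fin c.L)) h
  next k := by
    refine ⟨P.part (c.speaker k), P.part_mem.2 (Finset.mem_univ _), fun ω ω' h => ?_⟩
    obtain ⟨hblock, htranscript⟩ := Prod.ext_iff.1 h
    obtain ⟨hobs, hrand⟩ := Prod.ext_iff.1
      (congrFun hblock ⟨c.speaker k, P.mem_part (Finset.mem_univ _)⟩)
    dsimp only [terminalRV] at hobs hrand htranscript
    simp only [transcript, hobs, hrand, htranscript]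

variable [MeasurableSpace Ω] {μ : Measure Ω} [IsProbabilityMeasure μ]

instance : IsProbabilityMeasure (c.law μ) := by
  unfold law
  infer_instance

lemma entropy_law_rand (B : Finset (Fin m)) :
    entropy (c.law μ) (fun ω (i : B) => ω.2 i) = ∑ i ∈ B, entropy (c.randLaw i).toMeasure id :=
  have hrand : Measurable fun (u : ∀ i, Fin (c.q i)) (i : B) => u i := by fun_prop
  (entropy_measurePreserving measurePreserving_snd hrand).trans
    (jointEntropy_measurePi (fun _ => measurable_id) B)

variable [∀ i, MeasurableSpace (𝒳 i)]

lemma measurable_terminalRV (hX : ∀ i, Measurable (X i)) (i : Fin m) :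
    Measurable (c.terminalRV X i) := by
  have := hX i
  unfold terminalRV obs
  fun_prop

variable [∀ i, MeasurableSingletonClass (𝒳 i)]

lemma measurable_of_obs [∀ i, Countable (𝒳 i)] (hX : ∀ i, Measurable (X i)) {T : Type*}
    [MeasurableSpace T] (f : (∀ i, Fin n → 𝒳 i) → (∀ i, Fin (c.q i)) → T) :
    Measurable fun ω : c.Sample Ω => f (c.obs X ω) ω.2 := by
  have hdata : Measurable fun ω : c.Sample Ω => (c.obs X ω, ω.2) := by
    unfold obs
    fun_prop
  exact (Measurable.of_discrete (f := Function.uncurry f)).comp hdata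

variable [∀ i, Fintype (𝒳 i)]

lemma entropy_law_obs (hX : ∀ i, Measurable (X i)) (B : Finset (Fin m)) :
    entropy (c.law μ) (fun ω s (i : B) => X i (ω.1 s)) = n * jointEntropy μ X B := by
  have hXB : Measurable fun ω (i : B) => X i ω := by fun_prop
  have hcopies : Measurable fun (ω : Fin n → Ω) s (i : B) => X i (ω s) := by fun_prop
  have hpi := entropy_measurePi_const (ι := Fin n) (μ := μ) hXB
  rw [Fintype.card_fin] at hpi
  exact (entropy_measurePreserving measurePreserving_fst hcopies).trans hpi

lemma jointEntropy_terminalRV (hX : ∀ i, Measurable (X i)) (B : Finset (Fin m)) :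
    jointEntropy (c.law μ) (c.terminalRV X) B =
      n * jointEntropy μ X B + ∑ i ∈ B, entropy (c.randLaw i).toMeasure id := by
  have hobs : Measurable fun (ω : Fin n → Ω) s (i : B) => X i (ω s) := by fun_prop
  have hrand : Measurable fun (u : ∀ i, Fin (c.q i)) (i : B) => u i := by fun_prop
  calc jointEntropy (c.law μ) (c.terminalRV X) B
      = entropy (c.law μ) (fun ω => (fun s (i : B) => X i (ω.1 s), fun i : B => ω.2 i)) := by
        have hterminal := c.measurable_terminalRV hX
        refine entropy_eq_of_factorsThrough (by fun_prop) (by fun_prop) (fun ω ω' h => ?_)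
          (fun ω ω' h => ?_)
        · simp_all [funext_iff, terminalRV, obs]
        · simp_all [funext_iff, terminalRV, obs]
    _ = _ := by
        rw [← c.entropy_law_obs hX B, ← c.entropy_law_rand (μ := μ) B]
        exact entropy_prodMk_of_indepFun (by fun_prop) (by fun_prop)
          (ProbabilityTheory.indepFun_prod hobs hrand)

lemma partitionInfo_terminalRV (hX : ∀ i, Measurable (X i))
    (P : Finpartition (Finset.univ : Finset (Fin m))) :
    partitionInfo (c.law μ) (c.terminalRV X) P = n * partitionInfo μ X P := by
  have hrand : ∑ B ∈ P.parts, ∑ i ∈ B, entropy (c.randLaw i).toMeasure id =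
      ∑ i, entropy (c.randLaw i).toMeasure id :=
    (Finset.sum_biUnion P.disjoint).symm.trans (Finset.sum_congr P.biUnion_parts fun _ _ => rfl)
  simp only [partitionInfo, c.jointEntropy_terminalRV hX, Finset.sum_add_distrib,
    ← Finset.mul_sum, hrand]
  ring

variable {c}

lemma IsSecretKey.condEntropy_keyRV_le {A : Finset (Fin m)} {ε : ℝ} (h : c.IsSecretKey X μ A ε)
    (hX : ∀ i, Measurable (X i)) {i : Fin m} (hi : i ∈ A) :
    condEntropy (c.law μ) (c.keyRV X) (fun ω => (c.terminalRV X i ω, c.publicRV X ω)) ≤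
      Real.log 2 + ε * Real.log c.keySize := by
  have hK : Measurable (c.keyRV X) := c.measurable_of_obs hX c.key
  have hF : Measurable (c.publicRV X) := c.measurable_of_obs hX fun x u => c.transcript x u c.slots
  have hset : MeasurableSet {ω | c.estimateRV X i ω = c.keyRV X ω} :=
    measurableSet_eq_fun (c.measurable_of_obs hX fun x u =>
      c.estimate i (x i) (u i) (c.transcript x u c.slots)) hK
  have herror : (c.law μ).real {ω | c.estimateRV X i ω ≠ c.keyRV X ω} ≤ ε := by
    have hcompl := probReal_compl_eq_one_sub (μ := c.law μ) hset
    rw [Set.compl_ofPred] at hcompl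
    linarith [h.recoverable i hi]
  have hfano := condEntropy_le_of_estimate (μ := c.law μ) hK
    ((c.measurable_terminalRV hX i).prodMk hF) fun z => c.estimate i z.1.1 z.1.2 z.2
  rw [Fintype.card_fin] at hfano
  exact hfano.trans <| add_le_add_right
    (mul_le_mul_of_nonneg_right herror (Real.log_natCast_nonneg _)) _

lemma IsSecretKey.card_parts_sub_one_mul_le {ε : ℝ} (h : c.IsSecretKey X μ Finset.univ ε)
    (hX : ∀ i, Measurable (X i)) (P : Finpartition (Finset.univ : Finset (Fin m))) :
    ((P.parts.card : ℝ) - 1) *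
        (entropy (c.law μ) (c.keyRV X) - mutualInfo (c.law μ) (c.keyRV X) (c.publicRV X)) ≤
      n * partitionInfo μ X P + P.parts.card * (Real.log 2 + ε * Real.log c.keySize) := by
  have hterminal := c.measurable_terminalRV hX
  have hK : Measurable (c.keyRV X) := c.measurable_of_obs hX c.key
  have hF : ∀ k, Measurable fun ω => c.transcript (c.obs X ω) ω.2 k := fun k =>
    c.measurable_of_obs hX fun x u => c.transcript x u k
  rw [entropy_sub_mutualInfo, ← c.partitionInfo_terminalRV hX]
  refine (c.isDiscussion_transcript P).card_sub_one_mul_condEntropy_le (fun B _ => by fun_prop) hF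
    hK (W := fun ω (i : (Finset.univ : Finset (Fin m))) => c.terminalRV X i ω)
    (fun ω ω' hω => funext fun i => ?_) c.slots fun B hB => ?_
  · exact congrFun (congrFun hω ⟨P.part i, P.part_mem.2 (Finset.mem_univ _)⟩)
      ⟨i, P.mem_part (Finset.mem_univ _)⟩
  · obtain ⟨i, hi⟩ := P.nonempty_of_mem_parts hB
    have hblock : Measurable fun ω (j : B) => c.terminalRV X j ω := by fun_prop
    exact (condEntropy_le_of_factorsThrough hK ((hterminal i).prodMk (hF c.slots))
      (hblock.prodMk (hF c.slots)) fun ω ω' hω =>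
        Prod.ext (congrFun (Prod.ext_iff.1 hω).1 ⟨i, hi⟩) (Prod.ext_iff.1 hω).2).trans
      (h.condEntropy_keyRV_le hX (Finset.mem_univ i))

end Scheme

section Capacity

variable {m : ℕ} {𝒳 : Fin m → Type*} [∀ i, Fintype (𝒳 i)] [∀ i, MeasurableSpace (𝒳 i)]
  [∀ i, MeasurableSingletonClass (𝒳 i)] {Ω : Type*} [MeasurableSpace Ω]
  {μ : Measure Ω} [IsProbabilityMeasure μ] {X : ∀ i, Ω → 𝒳 i} {ε R : ℝ}

lemma Scheme.IsSecretKey.mul_entropy_div_le {n : ℕ} {c : Scheme m 𝒳 n}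
    (h : c.IsSecretKey X μ Finset.univ ε) (hX : ∀ i, Measurable (X i)) (hn : 0 < n) (hε : 0 ≤ ε)
    (P : Finpartition (Finset.univ : Finset (Fin m))) (hP : 1 ≤ P.parts.card) :
    ((P.parts.card : ℝ) - 1 - P.parts.card * ε) * (entropy (c.law μ) (c.keyRV X) / n) ≤
      partitionInfo μ X P + ((P.parts.card : ℝ) - 1) * ε +
        P.parts.card * (Real.log 2 / n + ε * ε) := by
  have hn' : (0 : ℝ) < n := by exact_mod_cast hn
  have hl : (1 : ℝ) ≤ P.parts.card := by exact_mod_cast hP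
  have hconverse := h.card_parts_sub_one_mul_le hX P
  have hsecret := mul_le_mul_of_nonneg_left h.secret (sub_nonneg.2 hl)
  have huniform := mul_le_mul_of_nonneg_left h.uniform (mul_nonneg (zero_le_one.trans hl) hε)
  have hrate := div_le_div_of_nonneg_right hconverse hn'.le
  rw [add_div, mul_div_cancel_left₀ _ hn'.ne', mul_div_assoc, mul_div_assoc, sub_div, add_div,
    mul_div_assoc ε] at hrate
  linarith

lemma IsAchievableRate.mul_sub_le (hR : IsAchievableRate μ X Finset.univ R)
    (hX : ∀ i, Measurable (X i)) (P : Finpartition (Finset.univ : Finset (Fin m)))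
    (hP : 2 ≤ P.parts.card) (hε : 0 < ε) (hε' : ε ≤ 1 / 2) :
    ((P.parts.card : ℝ) - 1 - P.parts.card * ε) * (R - ε) ≤
      partitionInfo μ X P + ((P.parts.card : ℝ) - 1) * ε + P.parts.card * (ε + ε * ε) := by
  have hl : (2 : ℝ) ≤ P.parts.card := by exact_mod_cast hP
  have hlog : ∀ᶠ n : ℕ in atTop, Real.log 2 / n ≤ ε :=
    (tendsto_const_div_atTop_nhds_zero_nat (Real.log 2)).eventually_le_const hε
  obtain ⟨n, ⟨c, hc, hRc⟩, hn, hlogn⟩ := ((hR ε hε).and ((eventually_gt_atTop 0).and hlog)).exists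
  have hcoeff : 0 ≤ (P.parts.card : ℝ) - 1 - P.parts.card * ε := by nlinarith
  calc ((P.parts.card : ℝ) - 1 - P.parts.card * ε) * (R - ε)
      ≤ ((P.parts.card : ℝ) - 1 - P.parts.card * ε) * (entropy (c.law μ) (c.keyRV X) / n) :=
        mul_le_mul_of_nonneg_left hRc hcoeff
    _ ≤ partitionInfo μ X P + ((P.parts.card : ℝ) - 1) * ε +
          P.parts.card * (Real.log 2 / n + ε * ε) :=
        hc.mul_entropy_div_le hX hn hε.le P (one_le_two.trans hP)
    _ ≤ _ := by gcongr

lemma IsAchievableRate.mul_le_partitionInfo (hR : IsAchievableRate μ X Finset.univ R)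
    (hX : ∀ i, Measurable (X i)) (P : Finpartition (Finset.univ : Finset (Fin m)))
    (hP : 2 ≤ P.parts.card) : ((P.parts.card : ℝ) - 1) * R ≤ partitionInfo μ X P := by
  set l : ℝ := (P.parts.card : ℝ)
  have hleft : Tendsto (fun ε : ℝ => (l - 1 - l * ε) * (R - ε)) (nhdsWithin 0 (Set.Ioi 0))
      (nhds ((l - 1) * R)) := by
    have hcont : Continuous fun ε : ℝ => (l - 1 - l * ε) * (R - ε) := by fun_prop
    simpa using (hcont.tendsto 0).mono_left (nhdsWithin_le_nhds (s := Set.Ioi 0))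
  have hright : Tendsto (fun ε : ℝ => partitionInfo μ X P + (l - 1) * ε + l * (ε + ε * ε))
      (nhdsWithin 0 (Set.Ioi 0)) (nhds (partitionInfo μ X P)) := by
    have hcont : Continuous fun ε : ℝ => partitionInfo μ X P + (l - 1) * ε + l * (ε + ε * ε) := by
      fun_prop
    simpa using (hcont.tendsto 0).mono_left (nhdsWithin_le_nhds (s := Set.Ioi 0))
  refine le_of_tendsto_of_tendsto hleft hright ?_
  filter_upwards [Ioc_mem_nhdsGT (by norm_num : (0 : ℝ) < 1 / 2)] with ε hε
  exact hR.mul_sub_le hX P hP hε.1 hε.2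

theorem secretKeyCapacity_le_partitionInfo_div (hX : ∀ i, Measurable (X i))
    (P : Finpartition (Finset.univ : Finset (Fin m))) (hP : 2 ≤ P.parts.card) :
    secretKeyCapacity μ X Finset.univ ≤
      ((partitionInfo μ X P / ((P.parts.card : ℝ) - 1) : ℝ) : EReal) := by
  refine iSup₂_le fun R hR => EReal.coe_le_coe_iff.2 ?_
  have hl : (2 : ℝ) ≤ P.parts.card := by exact_mod_cast hP
  rw [le_div_iff₀ (by linarith), mul_comm]
  exact hR.mul_le_partitionInfo hX P hP

end Capacity

section MultiCuts

variable {m : ℕ}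

lemma minNormalizedWeight_le_minCutWeight (w : Fin m → Fin m → ℝ) :
    minNormalizedWeight w ≤ minCutWeight w := by
  refine le_iInf₂ fun P hP => (iInf₂_le P hP.ge).trans ?_
  rw [normalizedWeight, hP]
  norm_num

lemma multiCutWeight_bot (w : Fin m → Fin m → ℝ) : multiCutWeight w ⊥ = totalWeight w := by
  have hpart : ∀ i : Fin m, (⊥ : Finpartition (Finset.univ : Finset (Fin m))).part i = {i} :=
    fun i => Finpartition.part_eq_of_mem _
      (Finpartition.mem_bot_iff.2 ⟨i, Finset.mem_univ i, rfl⟩) (Finset.mem_singleton_self i)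
  rw [multiCutWeight, totalWeight]
  simp_rw [hpart, Finset.singleton_inj.ne]
  exact Finset.sum_congr (Finset.filter_congr fun e _ => and_iff_left_of_imp ne_of_lt)
    fun _ _ => rfl

lemma minNormalizedWeight_le_totalWeight (hm : 2 ≤ m) (w : Fin m → Fin m → ℝ) :
    minNormalizedWeight w ≤ ((totalWeight w / ((m : ℝ) - 1) : ℝ) : EReal) := by
  have hcard : (⊥ : Finpartition (Finset.univ : Finset (Fin m))).parts.card = m := by
    rw [Finpartition.card_bot, Finset.card_univ, Fintype.card_fin]
  refine (iInf₂_le (⊥ : Finpartition (Finset.univ : Finset (Fin m)))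
    (hm.trans hcard.ge)).trans_eq ?_
  rw [normalizedWeight, hcard, multiCutWeight_bot]

end MultiCuts

section Pairs

variable {m : ℕ}

/-- The index set of the variables `Y_{i,j}`, `i ≠ j`, of a network of `m` terminals. -/
abbrev OffDiag (m : ℕ) : Type := {p : Fin m × Fin m // p.1 ≠ p.2}

/-- The edges of the complete graph, each listed once, with the smaller end-node first. -/
def edges (m : ℕ) : Finset (Fin m × Fin m) := {e : Fin m × Fin m | e.1 < e.2}

/-- The indices of the two variables `Y_{i,j}`, `Y_{j,i}` that sit on the edge `e = (i, j)`. -/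
def orientations (e : Fin m × Fin m) : Finset (OffDiag m) :=
  {p : OffDiag m | p.1 = e ∨ p.1 = e.swap}

/-- The indices of the variables `Y_{i,j}` seen by the terminals `i` in `B`. -/
def pairsFrom (B : Finset (Fin m)) : Finset (OffDiag m) := {p : OffDiag m | p.1.1 ∈ B}

lemma mem_orientations {e : Fin m × Fin m} {p : OffDiag m} :
    p ∈ orientations e ↔ p.1 = e ∨ p.1 = e.swap := by simp [orientations]

lemma mem_pairsFrom {B : Finset (Fin m)} {p : OffDiag m} : p ∈ pairsFrom B ↔ p.1.1 ∈ B := by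
  simp [pairsFrom]

lemma orientations_mk {i j : Fin m} (hij : i ≠ j) :
    orientations (i, j) = {⟨(i, j), hij⟩, ⟨(j, i), hij.symm⟩} := by
  ext p
  simp [mem_orientations, Subtype.ext_iff]

lemma pairwiseDisjoint_orientations :
    (edges m : Set (Fin m × Fin m)).PairwiseDisjoint orientations := by
  rintro ⟨i, j⟩ he ⟨k, l⟩ hf hne
  simp only [edges, Finset.coe_filter, Finset.mem_univ, true_and, Set.mem_ofPred_eq] at he hf
  refine Finset.disjoint_left.2 fun p hp hp' => ?_
  simp only [mem_orientations, Prod.ext_iff, Prod.swap_prod_mk] at hp hp'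
  simp only [ne_eq, Prod.mk.injEq] at hne
  omega

lemma biUnion_orientations : (edges m).biUnion orientations = Finset.univ := by
  ext ⟨⟨i, j⟩, hij⟩
  simp only [edges, mem_orientations, Finset.mem_biUnion, Finset.mem_filter, Finset.mem_univ,
    true_and, iff_true]
  rcases lt_or_gt_of_ne hij with h | h
  · exact ⟨(i, j), h, Or.inl rfl⟩
  · exact ⟨(j, i), h, Or.inr rfl⟩

lemma sum_parts_ite_mem {ι : Type*} [Fintype ι] [DecidableEq ι]
    (P : Finpartition (Finset.univ : Finset ι)) (i : ι) (f : Finset ι → ℝ) :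
    ∑ B ∈ P.parts, (if i ∈ B then f B else 0) = f (P.part i) := by
  have hpart : P.part i ∈ P.parts := P.part_mem.2 (Finset.mem_univ i)
  rw [Finset.sum_congr rfl fun B hB => if_congr (P.part_eq_iff_mem hB).symm rfl rfl,
    Finset.sum_ite_eq, if_pos hpart]

end Pairs

section Network

variable {m : ℕ} {α : Fin m → Fin m → Type*} {Ω : Type*}

/-- The variables `Y_{i,j}`, `i ≠ j`, of a network as a single family. -/
def pairs (Y : ∀ i j, Ω → α i j) (p : OffDiag m) : Ω → α p.1.1 p.1.2 := Y p.1.1 p.1.2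

variable [MeasurableSpace Ω] [∀ i j, MeasurableSpace (α i j)] {Y : ∀ i j, Ω → α i j}

lemma measurable_pairs (hY : ∀ i j, i ≠ j → Measurable (Y i j)) (p : OffDiag m) :
    Measurable (pairs Y p) := hY _ _ p.2

lemma measurable_observation (hY : ∀ i j, i ≠ j → Measurable (Y i j)) (i : Fin m) :
    Measurable (observation Y i) :=
  measurable_pi_lambda _ fun j => hY i j j.2.symm

variable [∀ i j, Fintype (α i j)] [∀ i j, MeasurableSingletonClass (α i j)] {μ : Measure Ω}
  [IsProbabilityMeasure μ]

lemma jointEntropy_observation (hY : ∀ i j, i ≠ j → Measurable (Y i j)) (B : Finset (Fin m)) :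
    jointEntropy μ (observation Y) B = jointEntropy μ (pairs Y) (pairsFrom B) := by
  have hX := measurable_observation hY
  have hpairs := measurable_pairs hY
  refine entropy_eq_of_factorsThrough (by fun_prop) (by fun_prop) (fun ω ω' h => ?_)
    (fun ω ω' h => ?_)
  · funext i j
    exact congrFun h ⟨⟨(i, j), j.2.symm⟩, mem_pairsFrom.2 i.2⟩
  · funext ⟨⟨⟨i, j⟩, hij⟩, hp⟩
    exact congrFun (congrFun h ⟨i, mem_pairsFrom.1 hp⟩) ⟨j, hij.symm⟩

lemma jointEntropy_orientations (hY : ∀ i j, i ≠ j → Measurable (Y i j)) {i j : Fin m}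
    (hij : i ≠ j) :
    jointEntropy μ (pairs Y) (orientations (i, j)) =
      entropy μ (Y i j) + entropy μ (Y j i) - edgeWeight μ Y i j := by
  have hpairs := measurable_pairs hY
  have hjoint : jointEntropy μ (pairs Y) (orientations (i, j)) =
      entropy μ fun ω => (Y i j ω, Y j i ω) := by
    rw [orientations_mk hij]
    refine entropy_eq_of_factorsThrough ((hY i j hij).prodMk (hY j i hij.symm)) (by fun_prop)
      (fun ω ω' h => ?_) (fun ω ω' h => ?_)
    · funext ⟨p, hp⟩
      rcases Finset.mem_insert.1 hp with rfl | hp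
      · exact (Prod.ext_iff.1 h).1
      · obtain rfl := Finset.mem_singleton.1 hp
        exact (Prod.ext_iff.1 h).2
    · exact Prod.ext (congrFun h ⟨⟨(i, j), hij⟩, by simp⟩)
        (congrFun h ⟨⟨(j, i), hij.symm⟩, by simp⟩)
  rw [hjoint, edgeWeight, mutualInfo]
  ring

lemma PairwiseIndependent.jointEntropy_orientations_add_compl_le (hind : PairwiseIndependent μ Y)
    (hY : ∀ i j, i ≠ j → Measurable (Y i j)) {i j : Fin m} (hij : i ≠ j) :
    jointEntropy μ (pairs Y) (orientations (i, j)) +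
      jointEntropy μ (pairs Y) (orientations (i, j))ᶜ ≤ jointEntropy μ (pairs Y) Finset.univ := by
  have hpairs := measurable_pairs hY
  set Z : Ω → ∀ p : {p : Fin m × Fin m // p.1 ≠ p.2 ∧ p ≠ (i, j) ∧ p ≠ (j, i)}, α p.1.1 p.1.2 :=
    fun ω p => Y p.1.1 p.1.2 ω
  have hZ : Measurable Z := measurable_pi_lambda _ fun p => hY _ _ p.2.1
  have hcompl : jointEntropy μ (pairs Y) (orientations (i, j))ᶜ ≤ entropy μ Z := by
    refine entropy_le_of_factorsThrough hZ fun ω ω' h => ?_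
    funext ⟨p, hp⟩
    rw [Finset.mem_compl, mem_orientations, not_or] at hp
    exact congrFun h ⟨p.1, p.2, hp⟩
  have huniv : entropy μ (fun ω => ((Y i j ω, Y j i ω), Z ω)) ≤
      jointEntropy μ (pairs Y) Finset.univ := by
    refine entropy_le_of_factorsThrough (by fun_prop) fun ω ω' h => ?_
    have heq : ∀ p : OffDiag m, pairs Y p ω = pairs Y p ω' :=
      fun p => congrFun h ⟨p, Finset.mem_univ p⟩
    exact Prod.ext (Prod.ext (heq ⟨(i, j), hij⟩) (heq ⟨(j, i), hij.symm⟩))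
      (funext fun p => heq ⟨p.1, p.2.1⟩)
  have hzero : entropy μ (fun ω => (Y i j ω, Y j i ω)) + entropy μ Z -
      entropy μ (fun ω => ((Y i j ω, Y j i ω), Z ω)) = 0 := hind i j hij
  have horient := jointEntropy_orientations (μ := μ) hY hij
  rw [edgeWeight, mutualInfo] at horient
  linarith

lemma jointEntropy_pairsFrom_inter_orientations (hY : ∀ i j, i ≠ j → Measurable (Y i j))
    (B : Finset (Fin m)) {i j : Fin m} (hij : i ≠ j) :
    jointEntropy μ (pairs Y) (pairsFrom B ∩ orientations (i, j)) =
      (if i ∈ B then entropy μ (Y i j) else 0) + (if j ∈ B then entropy μ (Y j i) else 0) -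
        if i ∈ B then if j ∈ B then edgeWeight μ Y i j else 0 else 0 := by
  have hi := mem_pairsFrom (B := B) (p := ⟨(i, j), hij⟩)
  have hj := mem_pairsFrom (B := B) (p := ⟨(j, i), hij.symm⟩)
  have hpairs := measurable_pairs hY
  by_cases hiB : i ∈ B <;> by_cases hjB : j ∈ B
  · have hsub : orientations (i, j) ⊆ pairsFrom B := by
      simp [orientations_mk hij, Finset.insert_subset_iff, hi, hj, hiB, hjB]
    simp [Finset.inter_eq_right.2 hsub, jointEntropy_orientations hY hij, hiB, hjB]
  · simp [orientations_mk hij, hi, hj, hiB, hjB, jointEntropy_singleton hpairs, pairs]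
  · simp [orientations_mk hij, hi, hj, hiB, hjB, jointEntropy_singleton hpairs, pairs]
  · simp [orientations_mk hij, hi, hj, hiB, hjB, jointEntropy_empty]

lemma sum_jointEntropy_pairsFrom_inter_orientations (hY : ∀ i j, i ≠ j → Measurable (Y i j))
    (P : Finpartition (Finset.univ : Finset (Fin m))) {i j : Fin m} (hij : i ≠ j) :
    ∑ B ∈ P.parts, jointEntropy μ (pairs Y) (pairsFrom B ∩ orientations (i, j)) =
      jointEntropy μ (pairs Y) (orientations (i, j)) +
        if P.part i ≠ P.part j then edgeWeight μ Y i j else 0 := by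
  have hmem : j ∈ P.part i ↔ P.part i = P.part j :=
    (P.mem_part_iff_part_eq_part (Finset.mem_univ j) (Finset.mem_univ i)).trans eq_comm
  simp_rw [jointEntropy_pairsFrom_inter_orientations hY _ hij, Finset.sum_sub_distrib,
    Finset.sum_add_distrib, sum_parts_ite_mem, hmem, jointEntropy_orientations hY hij, ne_eq,
    ite_not]
  split_ifs <;> ring

theorem partitionInfo_observation_le_multiCutWeight (hY : ∀ i j, i ≠ j → Measurable (Y i j))
    (hind : PairwiseIndependent μ Y) (P : Finpartition (Finset.univ : Finset (Fin m))) :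
    partitionInfo μ (observation Y) P ≤ multiCutWeight (edgeWeight μ Y) P := by
  have hne : ∀ e ∈ edges m, e.1 ≠ e.2 := fun e he => (Finset.mem_filter.1 he).2.ne
  have hblock : ∀ B : Finset (Fin m), jointEntropy μ (pairs Y) (pairsFrom B) ≤
      ∑ e ∈ edges m, jointEntropy μ (pairs Y) (pairsFrom B ∩ orientations e) := fun B => by
    simpa only [← Finset.inter_biUnion, biUnion_orientations, Finset.inter_univ] using
      jointEntropy_biUnion_le_sum (μ := μ) (measurable_pairs hY) (edges m)
        fun e => pairsFrom B ∩ orientations e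
  have htotal : ∑ e ∈ edges m, jointEntropy μ (pairs Y) (orientations e) ≤
      jointEntropy μ (pairs Y) Finset.univ := by
    simpa only [biUnion_orientations] using
      sum_jointEntropy_le_biUnion (measurable_pairs hY) (edges m) orientations
        pairwiseDisjoint_orientations
        fun e he => hind.jointEntropy_orientations_add_compl_le hY (hne e he)
  have huniv : pairsFrom (Finset.univ : Finset (Fin m)) = Finset.univ := by simp [pairsFrom]
  simp_rw [partitionInfo, jointEntropy_observation hY, huniv, sub_le_iff_le_add']
  calc ∑ B ∈ P.parts, jointEntropy μ (pairs Y) (pairsFrom B)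
      ≤ ∑ e ∈ edges m, ∑ B ∈ P.parts,
          jointEntropy μ (pairs Y) (pairsFrom B ∩ orientations e) :=
        (Finset.sum_le_sum fun B _ => hblock B).trans_eq Finset.sum_comm
    _ = ∑ e ∈ edges m, (jointEntropy μ (pairs Y) (orientations e) +
          if P.part e.1 ≠ P.part e.2 then edgeWeight μ Y e.1 e.2 else 0) :=
        Finset.sum_congr rfl fun e he =>
          sum_jointEntropy_pairsFrom_inter_orientations hY P (hne e he)
    _ = ∑ e ∈ edges m, jointEntropy μ (pairs Y) (orientations e) +
          multiCutWeight (edgeWeight μ Y) P := by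
        rw [Finset.sum_add_distrib, ← Finset.sum_filter, edges, Finset.filter_filter,
          multiCutWeight]
    _ ≤ _ := by gcongr

theorem secretKeyCapacity_le_minNormalizedWeight (hY : ∀ i j, i ≠ j → Measurable (Y i j))
    (hind : PairwiseIndependent μ Y) :
    secretKeyCapacity μ (observation Y) Finset.univ ≤ minNormalizedWeight (edgeWeight μ Y) := by
  refine le_iInf₂ fun P hP => (secretKeyCapacity_le_partitionInfo_div
    (measurable_observation hY) P hP).trans (EReal.coe_le_coe_iff.2 ?_)
  have hl : (2 : ℝ) ≤ P.parts.card := by exact_mod_cast hP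
  exact div_le_div_of_nonneg_right (partitionInfo_observation_le_multiCutWeight hY hind P)
    (by linarith)

end Network
end GroupKey

open GroupKey in
theorem corollary1 {m : ℕ} (hm : 2 ≤ m) {Ω : Type*} [MeasurableSpace Ω]
    (μ : MeasureTheory.Measure Ω) [MeasureTheory.IsProbabilityMeasure μ]
    {α : Fin m → Fin m → Type*} [∀ i j, Fintype (α i j)] [∀ i j, MeasurableSpace (α i j)]
    [∀ i j, MeasurableSingletonClass (α i j)]
    (Y : ∀ i j, Ω → α i j) (hY : ∀ i j, i ≠ j → Measurable (Y i j))
    (hind : PairwiseIndependent μ Y) :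
    secretKeyCapacity μ (observation Y) Finset.univ ≤ minNormalizedWeight (edgeWeight μ Y) ∧
    (minNormalizedWeight (edgeWeight μ Y) ≤ minCutWeight (edgeWeight μ Y) ∧
      secretKeyCapacity μ (observation Y) Finset.univ ≤ minCutWeight (edgeWeight μ Y)) ∧
    (minNormalizedWeight (edgeWeight μ Y) ≤
        ((totalWeight (edgeWeight μ Y) / ((m : ℝ) - 1) : ℝ) : EReal) ∧
      secretKeyCapacity μ (observation Y) Finset.univ ≤
        ((totalWeight (edgeWeight μ Y) / ((m : ℝ) - 1) : ℝ) : EReal)) := by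
  have hcapacity := secretKeyCapacity_le_minNormalizedWeight hY hind
  have hcut := minNormalizedWeight_le_minCutWeight (edgeWeight μ Y)
  have htotal := minNormalizedWeight_le_totalWeight hm (edgeWeight μ Y)
  exact ⟨hcapacity, ⟨hcut, hcapacity.trans hcut⟩, ⟨htotal, hcapacity.trans htotal⟩⟩
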